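/- Setting. Let $E$ be a locally compact, second countable Hausdorff space with its Borel $\sigma$-algebra (for example $E=\mathbb{R}^d$) and let $X=(X_t)_{t\ge 0}$ be a time-homogeneous Markov process in $E$ with right-continuous paths with left limits and with the Feller property (for every bounded continuous $g$ and $t\ge 0$ the function $x\mapsto \mathbb{E}_x[g(X_t)]$ is continuous), where $\mathbb{P}_x$ is the law of the process started at $x\in E$. Let $U\subseteq E$ be compact, $\delta>0$, and let $f\colon E\to\mathbb{R}$, $c\colon E\times U\to\mathbb{R}$. For $\gamma\in\mathbb{R}$ and a random variable $Z$ put $\mu_x^\gamma(Z):=\frac1\gamma\ln\mathbb{E}_x[e^{\gamma Z}]$ if $\gamma\ne0$ and $\mu^0_x(Z):=\mathbb{E}_x[Z]$. Let $\omega\colon E\to[0,\infty)$ be continuous. For $\beta>0$ and $g\colon E\to\mathbb{R}$ put \[ \|g\|_{\omega}:=\sup_{x\in E}\frac{|g(x)|}{1+\omega(x)},\qquad \|g\|_{\beta,\omega\text{-span}}:=\sup_{x,y\in E}\frac{g(x)-g(y)}{2+\beta\omega(x)+\beta\omega(y)},\qquad \|g\|_{\omega\text{-span}}:=\|g\|_{1,\omega\text{-span}},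 \] and let $C_\omega(E)$ be the set of continuous $g\colon E\to\mathbb{R}$ with $\|g\|_\omega<\infty$. Assume: (A.1) $f\in C_\omega(E)$. (A.2) $c$ is continuous, there is $c_0<0$ with $c(x,\xi)\le c_0$ for all $x\in E$, $\xi\in U$, and $\hat c(x):=\inf_{\xi\in U}c(x,\xi)$ satisfies $\|\hat c\|_\omega<\infty$. (A.3) There are $b_1\in(0,1)$ and functions $M_1,M_2\colon\mathbb{R}\to\mathbb{R}$ such that for all $\gamma\in\mathbb{R}$ and $x\in E$ \[ \mu_x^\gamma\Big(\int_0^\delta\omega(X_s)\,ds\Big)\le\omega(x)+M_1(\gamma)\quad\text{and}\quad \mu_x^\gamma(\omega(X_\delta))\le b_1\omega(x)+M_2(\gamma). \] (A.4) For every $R>0$ there are $d>0$ and a probability measure $\nu$ on $E$ with $\nu(U)>0$ such that $\mathbb{P}_x[X_\delta\in A]\ge d\,\nu(A)$ for all Borel $A\subseteq E$ and all $x\in E$ with $\omega(x)\le R$. Theorem. Fix $\gamma<0$ and, for $g\in C_\omega(E)$ and $x\in E$, let $T_\gamma g(x):=\gamma R_\gamma(g/\gamma)(x)$, where \[ R_\gamma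 g(x):=\max\Big\{\mu_x^\gamma\Big(\int_0^\delta f(X_s)\,ds+g(X_\delta)\Big),\ \sup_{\xi\in U}\Big[\mu_\xi^\gamma\Big(\int_0^\delta f(X_s)\,ds+g(X_\delta)\Big)+c(x,\xi)\Big]\Big\}. \] Then $T_\gamma g$ is finite-valued for every $g\in C_\omega(E)$, and for all sufficiently small $\beta>0$ the operator $T_\gamma$ is a local contraction under $\|\cdot\|_{\beta,\omega\text{-span}}$: there is a function $\beta_0\colon[0,\infty)\to(0,1)$ such that for every function $\beta\colon[0,\infty)\to(0,1)$ with $\beta\le\beta_0$ there is a function $L\colon[0,\infty)\to(0,1)$ such that, for every $M\ge0$, \[ \|T_\gamma f_1-T_\gamma f_2\|_{\beta(M),\omega\text{-span}}\le L(M)\,\|f_1-f_2\|_{\beta(M),\omega\text{-span}} \] for all $f_1,f_2\in C_\omega(E)$ with $\|f_1\|_{\omega\text{-span}}\le M$ and $\|f_2\|_{\omega\text{-span}}\le M$. -/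

import Mathlib

open MeasureTheory Set Filter Topology
open scoped NNReal ENNReal BoundedContinuousFunction

noncomputable section

/-- A time-homogeneous Feller-Markov process with state space `E`, given as a Markov family:
one process `X` on a filtered measurable space, and for every initial state `x` the law `P x`
of the (uncontrolled) process started from `x`. The transition semigroup is
`(P_t g)(x) = 𝔼_x[g(X_t)]`. -/
structure FellerMarkovProcess (E : Type*) [TopologicalSpace E] [MeasurableSpace E]
    (Ω : Type*) [mΩ : MeasurableSpace Ω] where
  /-- the filtration -/
  ℱ : Filtration ℝ≥0 mΩ
  /-- the process -/
  X : ℝ≥0 → Ω → E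
  /-- the law with initial state `x` -/
  P : E → Measure Ω
  prob : ∀ x, IsProbabilityMeasure (P x)
  adapted : ∀ t, Measurable[ℱ t] (X t)
  /-- every path is right-continuous with left limits -/
  cadlag : ∀ w t, ContinuousWithinAt (fun s => X s w) (Ici t) t ∧
    ∃ l, Tendsto (fun s => X s w) (𝓝[<] t) (𝓝 l)
  start : ∀ x, ∀ᵐ w ∂(P x), X 0 w = x
  measurable_transition : ∀ t (B : Set E), MeasurableSet B →
    Measurable fun x => P x (X t ⁻¹' B)
  /-- Markov property: `ℙ_x[X_{s+t} ∈ B | ℱ_s] = ℙ_{X_s}[X_t ∈ B]` almost surely -/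
  markov : ∀ x s t (B : Set E), MeasurableSet B →
    (P x)[(X (s + t) ⁻¹' B).indicator (fun _ => (1 : ℝ)) | ℱ s]
      =ᵐ[P x] fun w => (P (X s w)).real (X t ⁻¹' B)
  /-- Feller property: the transition semigroup maps bounded continuous functions to
  (bounded) continuous functions -/
  feller : ∀ t (g : E →ᵇ ℝ), Continuous fun x => ∫ w, g (X t w) ∂(P x)

/-- The entropic utility `μ^γ(Z) = (1/γ) ln 𝔼[exp(γ Z)]` for `γ ≠ 0`, and `μ^0(Z) = 𝔼[Z]`, as an
extended real number (the expectations are extended-valued as well). -/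
def entropicUtility {Ω : Type*} [MeasurableSpace Ω] (γ : ℝ) (P : Measure Ω) (Z : Ω → ℝ) : EReal :=
  if γ = 0 then
    ((∫⁻ w, ENNReal.ofReal (Z w) ∂P : ℝ≥0∞) : EReal)
      - ((∫⁻ w, ENNReal.ofReal (-Z w) ∂P : ℝ≥0∞) : EReal)
  else ((1 / γ : ℝ) : EReal) * ENNReal.log (∫⁻ w, ENNReal.ofReal (Real.exp (γ * Z w)) ∂P)

section Weighted

variable {E : Type*}

/-- The (shrunk) weighted norm `‖g‖_{β,ω} = sup_x |g x| / (1 + β ω(x))`, with values in `[0,∞]`. -/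
def weightedNorm (β : ℝ) (ω : E → ℝ) (g : E → ℝ) : ℝ≥0∞ :=
  ⨆ x, ENNReal.ofReal (|g x| / (1 + β * ω x))

/-- The weighted span seminorm
`‖g‖_{β,ω-span} = sup_{x,y} (g x - g y) / (2 + β ω(x) + β ω(y))`, with values in `[0,∞]`
(the supremum is nonnegative, by `x = y`). -/
def weightedSpan (β : ℝ) (ω : E → ℝ) (g : E → ℝ) : ℝ≥0∞ :=
  ⨆ x, ⨆ y, ENNReal.ofReal ((g x - g y) / (2 + β * ω x + β * ω y))

/-- The space `C_ω(E)` of continuous functions with finite `ω`-norm. -/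
def WeightedContinuous [TopologicalSpace E] (ω : E → ℝ) (g : E → ℝ) : Prop :=
  Continuous g ∧ weightedNorm 1 ω g < ∞

end Weighted

section Bellman

variable {E : Type*} [TopologicalSpace E] [MeasurableSpace E] {Ω : Type*} [MeasurableSpace Ω]

/-- `∫_0^δ g(X_s) ds`, along the path `w`. -/
def FellerMarkovProcess.timeIntegral (X : FellerMarkovProcess E Ω) (δ : ℝ≥0) (g : E → ℝ)
    (w : Ω) : ℝ :=
  ∫ s in (0 : ℝ)..(δ : ℝ), g (X.X s.toNNReal w)

/-- The state from which the process evolves after action `a = (a¹, ξ)` in state `x`: `x` if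
there is no impulse, `ξ` if there is one. -/
def postActionState {U : Set E} (x : E) (a : Bool × U) : E := if a.1 then (a.2 : E) else x

/-- The cost of an action: `0` if there is no impulse, `c(x, ξ)` for an impulse to `ξ`. -/
def actionCost {U : Set E} (c : E → U → ℝ) (x : E) (a : Bool × U) : ℝ :=
  if a.1 then c x a.2 else 0

/-- The Bellman operator
`R_γ g(x) = sup_{a ∈ {0,1} × U} (μ_x^{γ,a}(∫_0^δ f(X_s) ds + g(X_δ)) + c̄(x,a))`. -/
def bellmanR (X : FellerMarkovProcess E Ω) {U : Set E} (f : E → ℝ) (c : E → U → ℝ) (δ : ℝ≥0)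
    (γ : ℝ) (g : E → ℝ) (x : E) : EReal :=
  ⨆ a : Bool × U,
    entropicUtility γ (X.P (postActionState x a)) (fun w => X.timeIntegral δ f w + g (X.X δ w))
      + (actionCost c x a : EReal)

/-- The associated operator `T_γ g = γ R_γ (g / γ)`. -/
def bellmanT (X : FellerMarkovProcess E Ω) {U : Set E} (f : E → ℝ) (c : E → U → ℝ) (δ : ℝ≥0)
    (γ : ℝ) (g : E → ℝ) (x : E) : EReal :=
  (γ : EReal) * bellmanR X f c δ γ (fun y => g y / γ) x

/-- The reward function is continuous with finite `ω`-norm. -/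
def RewardCondition (ω f : E → ℝ) : Prop := WeightedContinuous ω f

/-- The shift cost function is continuous, bounded above by a negative constant, and
`x ↦ inf_{ξ ∈ U} c(x, ξ)` has finite `ω`-norm. -/
def ShiftCostCondition {U : Set E} (ω : E → ℝ) (c : E → U → ℝ) : Prop :=
  Continuous (Function.uncurry c) ∧ (∃ c₀ < 0, ∀ x ξ, c x ξ ≤ c₀) ∧
    weightedNorm 1 ω (fun x => ⨅ ξ, c x ξ) < ∞

/-- Geometric drift with controllable noise. -/
def GeometricDrift (X : FellerMarkovProcess E Ω) (δ : ℝ≥0) (ω : E → ℝ) : Prop :=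
  ∃ b₁ ∈ Ioo (0 : ℝ) 1, ∃ M₁ M₂ : ℝ → ℝ, ∀ (γ : ℝ) (x : E),
    entropicUtility γ (X.P x) (X.timeIntegral δ ω) ≤ ((ω x + M₁ γ : ℝ) : EReal) ∧
    entropicUtility γ (X.P x) (fun w => ω (X.X δ w)) ≤ ((b₁ * ω x + M₂ γ : ℝ) : EReal)

/-- Local minorization on the sublevel sets `C_R = {ω ≤ R}`, by measures which charge the
set `U` of shifts. -/
def LocalMinorization (X : FellerMarkovProcess E Ω) (δ : ℝ≥0) (ω : E → ℝ) (U : Set E) : Prop :=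
  ∀ R : ℝ, 0 < R → ∃ d : ℝ, 0 < d ∧ ∃ ν : Measure E, IsProbabilityMeasure ν ∧
    (∀ x, ω x ≤ R → ∀ A, MeasurableSet A → ENNReal.ofReal d * ν A ≤ X.P x (X.X δ ⁻¹' A)) ∧
    0 < ν U

end Bellman

end

/-!
Write `L_z(g) = log 𝔼_z[exp(γ ∫_0^δ f(X_s) ds + g(X_δ))]` (`logLaplace`). Since `γ < 0`,
`T_γ g(x)` is the infimum over the actions `a` of `L_z(g) + γ c̄(x, a)`, where the state `z` after
the action is `x` or lies in `U`. In the difference `T_γ f₁ - T_γ f₂` the costs cancel, and by the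
Gibbs variational principle `L_z(f₁) - L_z(f₂)` is at most the integral of `f₁ - f₂` against the
law `Q_{z,f₁}` of `X_δ` under the measure tilted by the payoff (`tiltedLaw`). So the weighted span
of `T_γ f₁ - T_γ f₂` is controlled by the differences `Q_{z,f₁}(h) - Q_{z',f₂}(h)` with
`h = f₁ - f₂`, and the argument of Hairer and Mattingly for Harris' theorem applies, given two
facts about the tilted laws that are uniform over functions of span at most `M`:

* a drift condition `∫ ω dQ_{z,g} ≤ b ω(z) + K` with `b < 1`
  (`GeometricDrift.exists_tilted_bounds`). The entropy inequality
  `l ∫ ω dQ ≤ log 𝔼[exp(F + l ω(X_δ))] - log 𝔼[exp F]` for the payoff `F`, together with the drift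
  hypothesis at all positive risk parameters, bounds the left side by
  `(l b₁ + const) ω(z) + const`, and the slope tends to `b₁ < 1` after division by `l` as `l → ∞`;
* total variation distance bounded away from one on the sublevel sets of `ω`
  (`LocalMinorization.exists_tiltedLaw_sub_le`). The running payoff is not a function of `X_δ`, so
  the minorizing measure `ν` does not survive the tilting, but by Cauchy-Schwarz
  `Q(S) ≥ const * ν(S)²`; as `S` or its complement has `ν`-mass at least `1/2`, this suffices.

An impulse replaces `x` by a point of the compact set `U`, on which `ω` is bounded; this only
changes the additive constant of the drift condition. When `ω(x) + ω(y)` is large, the drift alone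
contracts; when it is small, the total variation bound does, provided that `β` is small compared
with the additive constant (`exists_contraction_constant`).
-/

/-! ### Weighted total variation -/

/-- A function whose increments are dominated by `V x + V y` is, up to a constant, dominated by `V`:
the weighted span seminorm is the quotient norm of the weighted norm modulo constants. -/
lemma exists_abs_sub_le_of_span_le {E : Type*} [Nonempty E] {h V : E → ℝ}
    (H : ∀ x y, h x - h y ≤ V x + V y) : ∃ κ, ∀ x, |h x - κ| ≤ V x := by
  have y₀ := Classical.arbitrary E
  have hb : BddAbove (range fun x => h x - V x) :=
    ⟨h y₀ + V y₀, by rintro _ ⟨x, rfl⟩; linarith [H x y₀]⟩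
  refine ⟨⨆ x, (h x - V x), fun x => abs_le.2 ⟨?_, ?_⟩⟩
  · have : ⨆ y, (h y - V y) ≤ h x + V x := ciSup_le fun y => by linarith [H y x]
    linarith
  · linarith [le_ciSup hb x]

/-- A bound on the total variation distance of two probability measures, and on their integrals of
`ω`, controls the difference of the integrals of a function of weighted span at most `D`. On
each part of a Hahn decomposition the centred function, which is at most `D * (1 + β * ω)` in
absolute value, is compared with this weight. -/
lemma integral_sub_integral_le_of_span_le {E : Type*} [MeasurableSpace E] {μ ν : Measure E}
    [IsProbabilityMeasure μ] [IsProbabilityMeasure ν] {h ω : E → ℝ} {θ D β : ℝ}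
    (hm : Measurable h) (hω0 : ∀ x, 0 ≤ ω x) (hωμ : Integrable ω μ) (hων : Integrable ω ν)
    (hD : 0 ≤ D) (hβ : 0 ≤ β) (H : ∀ x y, h x - h y ≤ D * (2 + β * ω x + β * ω y))
    (hθ : ∀ s, MeasurableSet s → μ.real s - ν.real s ≤ θ) :
    ∫ x, h x ∂μ - ∫ x, h x ∂ν ≤ D * (2 * θ + β * ∫ x, ω x ∂μ + β * ∫ x, ω x ∂ν) := by
  have : Nonempty E := nonempty_of_isProbabilityMeasure μ
  obtain ⟨κ, hκ⟩ := exists_abs_sub_le_of_span_le (h := h) (V := fun x => D * (1 + β * ω x))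
    (fun x y => (H x y).trans_eq (by ring))
  have hVμ : Integrable (fun x => D * (1 + β * ω x)) μ :=
    ((integrable_const _).add (hωμ.const_mul _)).const_mul _
  have hVν : Integrable (fun x => D * (1 + β * ω x)) ν :=
    ((integrable_const _).add (hων.const_mul _)).const_mul _
  have hgμ : Integrable (fun x => h x - κ) μ :=
    hVμ.mono' (hm.sub_const _).aestronglyMeasurable (ae_of_all _ hκ)
  have hgν : Integrable (fun x => h x - κ) ν :=
    hVν.mono' (hm.sub_const _).aestronglyMeasurable (ae_of_all _ hκ)
  have e1 : ∫ x, h x ∂μ - ∫ x, h x ∂ν = ∫ x, (h x - κ) ∂μ - ∫ x, (h x - κ) ∂ν := by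
    have h1 : Integrable h μ := (hgμ.add (integrable_const κ)).congr (ae_of_all _ fun x => by simp)
    have h2 : Integrable h ν := (hgν.add (integrable_const κ)).congr (ae_of_all _ fun x => by simp)
    rw [integral_sub h1 (integrable_const _), integral_sub h2 (integrable_const _)]
    simp
  obtain ⟨s, hs, hsμ, hsν⟩ := hahn_decomposition μ ν
  have le1 : ν.restrict s ≤ μ.restrict s := Measure.le_iff.2 fun t ht => by
    rw [Measure.restrict_apply ht, Measure.restrict_apply ht]
    exact hsμ _ (ht.inter hs) inter_subset_right
  have le2 : μ.restrict sᶜ ≤ ν.restrict sᶜ := Measure.le_iff.2 fun t ht => by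
    rw [Measure.restrict_apply ht, Measure.restrict_apply ht]
    exact hsν _ (ht.inter hs.compl) inter_subset_right
  have i1 := integral_mono_measure (f := fun x => D * (1 + β * ω x) - (h x - κ)) le1
    (ae_of_all _ fun x => sub_nonneg.2 (abs_le.1 (hκ x)).2)
    (hVμ.sub hgμ).integrableOn
  have i2 := integral_mono_measure (f := fun x => D * (1 + β * ω x) + (h x - κ)) le2
    (ae_of_all _ fun x => by
      have := (abs_le.1 (hκ x)).1
      show 0 ≤ D * (1 + β * ω x) + (h x - κ)
      linarith)
    (hVν.add hgν).integrableOn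
  rw [integral_sub hVν.integrableOn hgν.integrableOn,
    integral_sub hVμ.integrableOn hgμ.integrableOn] at i1
  rw [integral_add hVν.integrableOn hgν.integrableOn,
    integral_add hVμ.integrableOn hgμ.integrableOn] at i2
  have eV : ∀ (ρ : Measure E) [IsFiniteMeasure ρ] (t : Set E), Integrable ω ρ →
      ∫ x in t, D * (1 + β * ω x) ∂ρ = D * (ρ.real t + β * ∫ x in t, ω x ∂ρ) := by
    intro ρ _ t hρ
    rw [integral_const_mul, integral_add (integrable_const _) (hρ.integrableOn.const_mul _),
      integral_const_mul]
    simp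
  rw [eV _ _ hωμ, eV _ _ hων] at i1 i2
  have c1 := integral_add_compl hs hgμ
  have c2 := integral_add_compl hs hgν
  have c3 := integral_add_compl hs hωμ
  have c4 := integral_add_compl hs hων
  have p1 : 0 ≤ ∫ x in s, ω x ∂ν := integral_nonneg hω0
  have p2 : 0 ≤ ∫ x in sᶜ, ω x ∂μ := integral_nonneg hω0
  have m1 := probReal_compl_eq_one_sub (μ := μ) hs
  have m2 := probReal_compl_eq_one_sub (μ := ν) hs
  rw [e1]
  calc _ ≤ D * (2 * (μ.real s - ν.real s) + β * (∫ x in s, ω x ∂μ - ∫ x in s, ω x ∂ν)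
        + β * (∫ x in sᶜ, ω x ∂ν - ∫ x in sᶜ, ω x ∂μ)) := by
        rw [m1, m2] at i2
        linarith
    _ ≤ _ := by
        have := hθ s hs
        gcongr <;> linarith

/-! ### Exponential tilting -/

section ExponentialTilting

variable {Ω : Type*} [MeasurableSpace Ω] {P : Measure Ω}

/-- One half of the Gibbs variational principle: Jensen's inequality for `G - F` under the measure
tilted by `F`. -/
lemma log_integral_exp_sub_le [IsProbabilityMeasure P] {F G : Ω → ℝ}
    (hF : Integrable (fun w => Real.exp (F w)) P)
    (hG : Integrable (fun w => Real.exp (G w)) P)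
    (hFG : Integrable (fun w => F w - G w) (P.tilted F)) :
    Real.log (∫ w, Real.exp (F w) ∂P) - Real.log (∫ w, Real.exp (G w) ∂P)
      ≤ ∫ w, (F w - G w) ∂(P.tilted F) := by
  have := isProbabilityMeasure_tilted hF
  have pF := integral_exp_pos hF
  have pG := integral_exp_pos hG
  have key : Real.exp (∫ w, (G w - F w) ∂(P.tilted F))
      ≤ ∫ w, Real.exp (G w - F w) ∂(P.tilted F) := by
    refine convexOn_exp.map_integral_le Real.continuous_exp.continuousOn isClosed_univ
      (by simp) ?_ ?_
    · exact hFG.neg.congr (ae_of_all _ fun x => by simp)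
    · show Integrable (fun w => Real.exp (G w - F w)) _
      rw [integrable_tilted_iff hF]
      simpa [← Real.exp_add] using hG
  have e : ∫ w, Real.exp (G w - F w) ∂(P.tilted F)
      = (∫ w, Real.exp (G w) ∂P) / ∫ w, Real.exp (F w) ∂P := by
    have := integral_exp_tilted (μ := P) F (fun w => G w - F w)
    simpa using this
  rw [e] at key
  have l := Real.log_le_log (Real.exp_pos _) key
  rw [Real.log_exp, Real.log_div pG.ne' pF.ne'] at l
  have : ∫ w, (F w - G w) ∂(P.tilted F) = - ∫ w, (G w - F w) ∂(P.tilted F) := by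
    rw [← integral_neg]; simp
  linarith

/-- The Cauchy-Schwarz inequality for `exp (F / 2) * exp (-F / 2)` on `A`: tilting by `F` cannot
make an event much less likely. -/
lemma measureReal_sq_le_tilted [IsProbabilityMeasure P] {F : Ω → ℝ}
    (hF : Integrable (fun w => Real.exp (F w)) P)
    (hF' : Integrable (fun w => Real.exp (-F w)) P) (A : Set Ω) :
    P.real A ^ 2 ≤ (P.tilted F).real A *
      ((∫ w, Real.exp (F w) ∂P) * ∫ w, Real.exp (-F w) ∂P) := by
  have pF := integral_exp_pos hF
  have pF' := integral_exp_pos hF'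
  set X := ∫ w in A, Real.exp (F w) ∂P with hX
  set Y := ∫ w, Real.exp (-F w) ∂P
  have hXle : 0 ≤ X := integral_nonneg fun w => (Real.exp_pos _).le
  have eA : (P.tilted F).real A * ∫ w, Real.exp (F w) ∂P = X := by
    rw [Measure.real, tilted_apply_eq_ofReal_integral, integral_div,
      ENNReal.toReal_ofReal (by positivity)]
    field_simp
    rfl
  rw [← mul_assoc, eA]
  -- integrate `exp (-F) * (t * exp F - 1) ^ 2 ≥ 0` over `A`
  have quad : ∀ t : ℝ, 0 ≤ t ^ 2 * X - 2 * t * P.real A + Y := by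
    intro t
    have hY : ∫ w in A, Real.exp (-F w) ∂P ≤ Y :=
      setIntegral_le_integral hF' (ae_of_all _ fun w => (Real.exp_pos _).le)
    have h0 : 0 ≤ ∫ w in A, (t ^ 2 * Real.exp (F w) - 2 * t + Real.exp (-F w)) ∂P := by
      refine integral_nonneg fun w => ?_
      show 0 ≤ t ^ 2 * Real.exp (F w) - 2 * t + Real.exp (-F w)
      have h1 : Real.exp (F w) * Real.exp (-F w) = 1 := by rw [← Real.exp_add]; simp
      have h2 : t ^ 2 * Real.exp (F w) - 2 * t + Real.exp (-F w)
          = Real.exp (-F w) * (t * Real.exp (F w) - 1) ^ 2 := by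
        linear_combination (-t ^ 2 * Real.exp (F w) + 2 * t) * h1
      rw [h2]; positivity
    have i1 : Integrable (fun w => t ^ 2 * Real.exp (F w)) (P.restrict A) :=
      hF.integrableOn.const_mul _
    have i2 : Integrable (fun w => t ^ 2 * Real.exp (F w) - 2 * t) (P.restrict A) :=
      i1.sub (integrable_const _)
    rw [integral_add i2 hF'.integrableOn,
      integral_sub i1 (integrable_const _), integral_const_mul] at h0
    simp only [integral_const, smul_eq_mul, measureReal_restrict_apply_univ] at h0
    linarith
  have := discrim_le_zero (a := X) (b := -2 * P.real A) (c := Y) fun t => by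
    have := quad t; nlinarith
  rw [discrim] at this
  nlinarith

/-- The entropy inequality for the tilted measure. The constants `Φ` and `Ψ` may contain opposite
multiples of an additive constant of `F`, which then cancel. -/
lemma integral_tilted_le [IsProbabilityMeasure P] {F B : Ω → ℝ} {l Φ Ψ : ℝ}
    (hF : Integrable (fun w => Real.exp (F w)) P)
    (hF' : Integrable (fun w => Real.exp (-F w)) P)
    (hFB : Integrable (fun w => Real.exp (F w + l * B w)) P)
    (hB : Integrable B (P.tilted F))
    (hΦ : ∫ w, Real.exp (F w + l * B w) ∂P ≤ Real.exp Φ)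
    (hΨ : ∫ w, Real.exp (-F w) ∂P ≤ Real.exp Ψ) :
    l * ∫ w, B w ∂(P.tilted F) ≤ Φ + Ψ := by
  have pF := integral_exp_pos hF
  have pF' := integral_exp_pos hF'
  have pFB := integral_exp_pos hFB
  have h1 := measureReal_sq_le_tilted hF hF' univ
  have := isProbabilityMeasure_tilted hF
  simp only [probReal_univ, one_pow, one_mul] at h1
  have h2 := log_integral_exp_sub_le hF hFB (by simpa using (hB.const_mul l).neg)
  simp only [sub_add_cancel_left, integral_neg, integral_const_mul] at h2
  have h3 := (Real.log_le_iff_le_exp pFB).2 hΦ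
  have h4 := (Real.log_le_iff_le_exp pF').2 hΨ
  have h5 := Real.log_nonneg h1
  rw [Real.log_mul pF.ne' pF'.ne'] at h5
  linarith

/-- Exponential moments of a sum. Bounds at the doubled parameters give the same constant as the
Cauchy-Schwarz inequality. -/
lemma integrable_exp_add {A B : Ω → ℝ} (hA : Measurable A) (hB : Measurable B) {a l s t : ℝ}
    (h1 : ∫⁻ w, ENNReal.ofReal (Real.exp (2 * a * A w)) ∂P ≤ ENNReal.ofReal (Real.exp (2 * s)))
    (h2 : ∫⁻ w, ENNReal.ofReal (Real.exp (2 * l * B w)) ∂P ≤ ENNReal.ofReal (Real.exp (2 * t))) :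
    Integrable (fun w => Real.exp (a * A w + l * B w)) P ∧
      ∫ w, Real.exp (a * A w + l * B w) ∂P ≤ Real.exp (s + t) := by
  have aux : ∀ (p q : ℝ) (Z : Ω → ℝ), Measurable Z →
      ∫⁻ w, ENNReal.ofReal (Real.exp (p * Z w)) ∂P ≤ ENNReal.ofReal (Real.exp q) →
      Integrable (fun w => Real.exp (p * Z w)) P ∧ ∫ w, Real.exp (p * Z w) ∂P ≤ Real.exp q := by
    intro p q Z hZ hb
    have hm : Measurable fun w => Real.exp (p * Z w) := (hZ.const_mul p).exp
    have hi : Integrable (fun w => Real.exp (p * Z w)) P :=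
      (lintegral_ofReal_ne_top_iff_integrable hm.aestronglyMeasurable
        (ae_of_all _ fun w => (Real.exp_pos _).le)).1 (hb.trans_lt ENNReal.ofReal_lt_top).ne
    refine ⟨hi, ?_⟩
    rw [← ofReal_integral_eq_lintegral_ofReal hi (ae_of_all _ fun w => (Real.exp_pos _).le)] at hb
    exact (ENNReal.ofReal_le_ofReal_iff (Real.exp_pos _).le).1 hb
  obtain ⟨iA, bA⟩ := aux _ _ _ hA h1
  obtain ⟨iB, bB⟩ := aux _ _ _ hB h2
  -- Young's inequality, with weights that make both terms contribute `exp (s + t) / 2`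
  have young : ∀ w, Real.exp (a * A w + l * B w) ≤
      Real.exp (t - s) / 2 * Real.exp (2 * a * A w) +
        Real.exp (s - t) / 2 * Real.exp (2 * l * B w) := by
    intro w
    set x := Real.exp ((t - s) / 2 + a * A w) with hx
    set y := Real.exp ((s - t) / 2 + l * B w) with hy
    have e1 : Real.exp (a * A w + l * B w) = x * y := by
      rw [hx, hy, ← Real.exp_add]; congr 1; ring
    have e2 : Real.exp (t - s) / 2 * Real.exp (2 * a * A w) = x ^ 2 / 2 := by
      rw [hx, ← Real.exp_nat_mul, div_mul_eq_mul_div, ← Real.exp_add]; congr 2; push_cast; ring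
    have e3 : Real.exp (s - t) / 2 * Real.exp (2 * l * B w) = y ^ 2 / 2 := by
      rw [hy, ← Real.exp_nat_mul, div_mul_eq_mul_div, ← Real.exp_add]; congr 2; push_cast; ring
    rw [e1, e2, e3]
    nlinarith [sq_nonneg (x - y)]
  have ig := (iA.const_mul (Real.exp (t - s) / 2)).add (iB.const_mul (Real.exp (s - t) / 2))
  have im : Integrable (fun w => Real.exp (a * A w + l * B w)) P :=
    ig.mono' ((hA.const_mul a).add (hB.const_mul l)).exp.aestronglyMeasurable
      (ae_of_all _ fun w => by
        rw [Real.norm_eq_abs, abs_of_pos (Real.exp_pos _)]; exact young w)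
  refine ⟨im, (integral_mono im ig young).trans ?_⟩
  rw [integral_add' (iA.const_mul _) (iB.const_mul _), integral_const_mul, integral_const_mul]
  calc _ ≤ Real.exp (t - s) / 2 * Real.exp (2 * s) + Real.exp (s - t) / 2 * Real.exp (2 * t) := by
        gcongr
    _ = _ := by
        rw [div_mul_eq_mul_div, div_mul_eq_mul_div, ← Real.exp_add, ← Real.exp_add,
          show t - s + 2 * s = s + t by ring, show s - t + 2 * t = s + t by ring]
        ring

end ExponentialTilting

/-! ### Time integrals along right-continuous paths -/

section Path

variable {E : Type*} [TopologicalSpace E] [MeasurableSpace E] {Ω : Type*} [MeasurableSpace Ω]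

lemma FellerMarkovProcess.measurable_X (X : FellerMarkovProcess E Ω) (t : ℝ≥0) :
    Measurable (X.X t) :=
  (X.adapted t).mono (X.ℱ.le t) le_rfl

/-- A path with right and left limits is locally bounded, hence bounded on compact intervals. -/
lemma FellerMarkovProcess.exists_abs_comp_le (X : FellerMarkovProcess E Ω) {g : E → ℝ}
    (hg : Continuous g) (δ : ℝ≥0) (w : Ω) : ∃ C, ∀ s ∈ Icc 0 δ, |g (X.X s w)| ≤ C := by
  refine isCompact_Icc.induction_on (p := fun S => ∃ C, ∀ s ∈ S, |g (X.X s w)| ≤ C)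
    ⟨0, by simp⟩ (fun S T hST ⟨C, hC⟩ => ⟨C, fun s hs => hC s (hST hs)⟩)
    (fun S T ⟨C, hC⟩ ⟨C', hC'⟩ => ⟨max C C', fun s hs => hs.elim
      (fun h => (hC s h).trans (le_max_left _ _)) fun h => (hC' s h).trans (le_max_right _ _)⟩) ?_
  intro t _
  obtain ⟨hr, l, hl⟩ := X.cadlag w t
  have key : ∀ {𝓕 : Filter ℝ≥0} {y : E}, Tendsto (fun s => X.X s w) 𝓕 (𝓝 y) →
      ∀ᶠ s in 𝓕, |g (X.X s w)| ≤ |g y| + 1 := fun {𝓕 y} h =>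
    (((hg.abs.tendsto y).comp h).eventually_lt_const (lt_add_one _)).mono fun s hs => hs.le
  have : ∀ᶠ s in 𝓝 t, |g (X.X s w)| ≤ max (|g (X.X t w)| + 1) (|g l| + 1) := by
    rw [← nhdsLT_sup_nhdsGE, eventually_sup]
    exact ⟨(key hl).mono fun s h => h.trans (le_max_right _ _),
      (key hr).mono fun s h => h.trans (le_max_left _ _)⟩
  exact ⟨_, mem_nhdsWithin_of_mem_nhds this, _, fun s hs => hs⟩

/-- Joint measurability in time and path, by right-continuity. -/
lemma FellerMarkovProcess.measurable_uncurry_comp [BorelSpace E] (X : FellerMarkovProcess E Ω)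
    {g : E → ℝ} (hg : Continuous g) : Measurable fun p : ℝ≥0 × Ω => g (X.X p.1 p.2) := by
  -- `τ n s` is the first multiple of `1 / (n + 1)` strictly after `s`
  let τ : ℕ → ℝ≥0 → ℝ≥0 := fun n s => ((⌊(n + 1 : ℝ≥0) * s⌋₊ : ℝ≥0) + 1) / (n + 1)
  have hτ : ∀ s, Tendsto (fun n => τ n s) atTop (𝓝[≥] s) := by
    intro s
    have low : ∀ n, s ≤ τ n s := fun n => by
      rw [le_div_iff₀ (by positivity), mul_comm]
      exact (Nat.lt_floor_add_one _).le
    have up : ∀ n : ℕ, τ n s ≤ s + 1 / ((n : ℝ≥0) + 1) := fun n => by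
      have e : (s + 1 / ((n : ℝ≥0) + 1)) * (n + 1) = (n + 1) * s + 1 := by field_simp
      rw [div_le_iff₀ (by positivity), e]
      gcongr
      exact Nat.floor_le zero_le
    refine tendsto_nhdsWithin_iff.2 ⟨?_, Eventually.of_forall low⟩
    refine tendsto_of_tendsto_of_tendsto_of_le_of_le tendsto_const_nhds ?_ low up
    simpa using (tendsto_const_nhds (x := s)).add
      (tendsto_one_div_add_atTop_nhds_zero_nat (𝕜 := ℝ≥0))
  refine measurable_of_tendsto_metrizable (f := fun n p => g (X.X (τ n p.1) p.2)) (fun n => ?_) ?_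
  · have h1 : Measurable fun q : ℕ × Ω => g (X.X (((q.1 : ℝ≥0) + 1) / (n + 1)) q.2) :=
      measurable_from_prod_countable_right fun k =>
        hg.measurable.comp (X.measurable_X (((k : ℝ≥0) + 1) / (n + 1)))
    have h2 : Measurable fun p : ℝ≥0 × Ω => (⌊(n + 1 : ℝ≥0) * p.1⌋₊, p.2) :=
      (Nat.measurable_floor.comp (measurable_fst.const_mul _)).prodMk measurable_snd
    have h3 := h1.comp h2
    simp only [Function.comp_def] at h3
    exact h3
  · refine tendsto_pi_nhds.2 fun p => ?_
    have hc : Tendsto (fun s => X.X s p.2) (𝓝[≥] p.1) (𝓝 (X.X p.1 p.2)) := (X.cadlag p.2 p.1).1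
    exact (hg.tendsto _).comp (hc.comp (hτ p.1))

lemma FellerMarkovProcess.measurable_timeIntegral [BorelSpace E] (X : FellerMarkovProcess E Ω)
    {g : E → ℝ} (hg : Continuous g) (δ : ℝ≥0) : Measurable (X.timeIntegral δ g) := by
  have h : Measurable fun p : Ω × ℝ => g (X.X p.2.toNNReal p.1) :=
    (X.measurable_uncurry_comp hg).comp
      ((measurable_real_toNNReal.comp measurable_snd).prodMk measurable_fst)
  have := h.stronglyMeasurable.integral_prod_right' (ν := volume.restrict (Ioc (0 : ℝ) δ))
  unfold FellerMarkovProcess.timeIntegral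
  simp only [intervalIntegral.integral_of_le δ.coe_nonneg]
  exact this.measurable

lemma FellerMarkovProcess.intervalIntegrable_comp [BorelSpace E] (X : FellerMarkovProcess E Ω)
    {g : E → ℝ} (hg : Continuous g) (δ : ℝ≥0) (w : Ω) :
    IntervalIntegrable (fun s : ℝ => g (X.X s.toNNReal w)) volume 0 δ := by
  obtain ⟨C, hC⟩ := X.exists_abs_comp_le hg δ w
  rw [intervalIntegrable_iff_integrableOn_Ioc_of_le δ.coe_nonneg]
  have hm : Measurable fun s : ℝ => g (X.X s.toNNReal w) :=
    (X.measurable_uncurry_comp hg).comp (measurable_real_toNNReal.prodMk measurable_const)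
  refine Measure.integrableOn_of_bounded (M := C) (by simp) hm.aestronglyMeasurable ?_
  refine (ae_restrict_iff' measurableSet_Ioc).2 (ae_of_all _ fun s hs => hC _ ⟨zero_le, ?_⟩)
  exact Real.toNNReal_le_iff_le_coe.2 hs.2

lemma FellerMarkovProcess.abs_timeIntegral_le [BorelSpace E] (X : FellerMarkovProcess E Ω)
    {g ω : E → ℝ} (hg : Continuous g) (hω : Continuous ω) {k : ℝ}
    (h : ∀ x, |g x| ≤ k * (1 + ω x)) (δ : ℝ≥0) (w : Ω) :
    |X.timeIntegral δ g w| ≤ k * (δ + X.timeIntegral δ ω w) := by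
  have i1 := X.intervalIntegrable_comp hg.abs δ w
  have i2 := X.intervalIntegrable_comp hω δ w
  unfold FellerMarkovProcess.timeIntegral
  calc _ ≤ ∫ s in (0 : ℝ)..δ, |g (X.X s.toNNReal w)| :=
        intervalIntegral.abs_integral_le_integral_abs δ.coe_nonneg
    _ ≤ ∫ s in (0 : ℝ)..δ, k * (1 + ω (X.X s.toNNReal w)) :=
        intervalIntegral.integral_mono_on δ.coe_nonneg i1
          ((intervalIntegrable_const.add i2).const_mul k) fun s _ => h _
    _ = _ := by
        rw [intervalIntegral.integral_const_mul,
          intervalIntegral.integral_add intervalIntegrable_const i2]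
        simp

end Path

/-! ### Entropic utility as a real number -/

section Entropic

variable {Ω : Type*} [MeasurableSpace Ω] {P : Measure Ω}

lemma lintegral_exp_le_of_entropicUtility_le {p r : ℝ} (hp : 0 < p) {Z : Ω → ℝ}
    (h : entropicUtility p P Z ≤ (r : EReal)) :
    ∫⁻ w, ENNReal.ofReal (Real.exp (p * Z w)) ∂P ≤ ENNReal.ofReal (Real.exp (p * r)) := by
  rw [entropicUtility, if_neg hp.ne'] at h
  rw [← ENNReal.log_le_log_iff, ENNReal.log_ofReal_of_pos (Real.exp_pos _), Real.log_exp]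
  generalize ENNReal.log _ = L at h
  induction L with
  | bot => exact bot_le
  | top =>
    rw [EReal.coe_mul_top_of_pos (by positivity)] at h
    exact absurd h (not_le.2 (EReal.coe_lt_top r))
  | coe y =>
    norm_cast at h ⊢
    rwa [one_div, inv_mul_le_iff₀ hp] at h

lemma entropicUtility_eq_coe [NeZero P] {p : ℝ} (hp : p ≠ 0) {Z : Ω → ℝ}
    (h : Integrable (fun w => Real.exp (p * Z w)) P) :
    entropicUtility p P Z
      = ((1 / p * Real.log (∫ w, Real.exp (p * Z w) ∂P) : ℝ) : EReal) := by
  rw [entropicUtility, if_neg hp,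
    ← ofReal_integral_eq_lintegral_ofReal h (ae_of_all _ fun w => (Real.exp_pos _).le),
    ENNReal.log_ofReal_of_pos (integral_exp_pos h), EReal.coe_mul]

end Entropic

/-! ### Tilted transition laws -/

section TiltedLaw

variable {E : Type*} [TopologicalSpace E] [MeasurableSpace E]
  {Ω : Type*} [MeasurableSpace Ω] {X : FellerMarkovProcess E Ω} {δ : ℝ≥0} {ω : E → ℝ}

instance (x : E) : IsProbabilityMeasure (X.P x) := X.prob x

/-- `F` is a payoff of moderate growth: up to an additive constant, it is at most
`a ∫_0^δ ω(X_s) ds + m ω(X_δ) + C` in absolute value. Functions of bounded weighted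
span give payoffs with common `a`, `m`, `C`, since the constant `κ` is free. -/
def ModerateGrowth (X : FellerMarkovProcess E Ω) (δ : ℝ≥0) (ω : E → ℝ) (a m C κ : ℝ)
    (F : Ω → ℝ) : Prop :=
  Measurable F ∧
    ∀ w, |F w - κ| ≤ a * X.timeIntegral δ ω w + m * ω (X.X δ w) + C

/-- The law of `X_δ` under the measure with density proportional to `exp F` with respect
to `P x`. -/
noncomputable def tiltedLaw (X : FellerMarkovProcess E Ω) (δ : ℝ≥0) (F : Ω → ℝ)
    (x : E) : Measure E :=
  ((X.P x).tilted F).map (X.X δ)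

/-- Any two tilted laws started in `{ω ≤ R}` have total variation distance at most `θ < 1`: a set or
its complement has `ν`-mass at least `1 / 2`, hence tilted mass bounded below. -/
lemma LocalMinorization.exists_tiltedLaw_sub_le {U : Set E} (hA4 : LocalMinorization X δ ω U)
    {k k' : ℝ} (hk : 0 ≤ k) {R : ℝ} (hR : 0 < R) :
    ∃ θ ∈ Ioo (0 : ℝ) 1, ∀ x x' F F', ω x ≤ R → ω x' ≤ R →
      IsProbabilityMeasure (tiltedLaw X δ F x) →
      (∀ S, MeasurableSet S → (X.P x).real (X.X δ ⁻¹' S) ^ 2 ≤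
        (tiltedLaw X δ F x).real S * Real.exp (2 * (k * ω x + k'))) →
      (∀ S, MeasurableSet S → (X.P x').real (X.X δ ⁻¹' S) ^ 2 ≤
        (tiltedLaw X δ F' x').real S * Real.exp (2 * (k * ω x' + k'))) →
      ∀ S, MeasurableSet S → (tiltedLaw X δ F x).real S - (tiltedLaw X δ F' x').real S ≤ θ := by
  obtain ⟨d, hd, ν, hν, h, -⟩ := hA4 R hR
  -- the minimum with `1 / 2` only serves to make `θ` positive
  have low : ∀ x F, ω x ≤ R → (∀ S, MeasurableSet S → (X.P x).real (X.X δ ⁻¹' S) ^ 2 ≤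
        (tiltedLaw X δ F x).real S * Real.exp (2 * (k * ω x + k'))) →
      ∀ S, MeasurableSet S → 1 / 2 ≤ ν.real S →
        min (1 / 2) ((d / 2) ^ 2 * Real.exp (-(2 * (k * R + k')))) ≤
          (tiltedLaw X δ F x).real S := by
    intro x F hx hT S hS hνS
    refine (min_le_right _ _).trans ?_
    have h1 : d * ν.real S ≤ (X.P x).real (X.X δ ⁻¹' S) := by
      have := ENNReal.toReal_mono (measure_ne_top _ _) (h x hx S hS)
      rwa [ENNReal.toReal_mul, ENNReal.toReal_ofReal hd.le] at this
    have h2 : d / 2 ≤ (X.P x).real (X.X δ ⁻¹' S) := by nlinarith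
    have h3 : (d / 2) ^ 2 ≤ (X.P x).real (X.X δ ⁻¹' S) ^ 2 := by gcongr
    have h4 : Real.exp (2 * (k * ω x + k')) ≤ Real.exp (2 * (k * R + k')) := by gcongr
    rw [Real.exp_neg, ← div_eq_mul_inv, div_le_iff₀ (Real.exp_pos _)]
    exact (h3.trans (hT S hS)).trans (mul_le_mul_of_nonneg_left h4 measureReal_nonneg)
  refine ⟨1 - min (1 / 2) ((d / 2) ^ 2 * Real.exp (-(2 * (k * R + k')))), ⟨?_, ?_⟩, ?_⟩
  · have := min_le_left (1 / 2 : ℝ) ((d / 2) ^ 2 * Real.exp (-(2 * (k * R + k'))))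
    linarith
  · have : 0 < min (1 / 2 : ℝ) ((d / 2) ^ 2 * Real.exp (-(2 * (k * R + k')))) := by positivity
    linarith
  · intro x x' F F' hx hx' hp hT hT' S hS
    rcases le_total (1 / 2) (ν.real S) with hνS | hνS
    · linarith [low x' F' hx' hT' S hS hνS, measureReal_le_one (μ := tiltedLaw X δ F x) (s := S)]
    · have h1 := probReal_compl_eq_one_sub (μ := ν) hS
      have h2 := probReal_compl_eq_one_sub (μ := tiltedLaw X δ F x) hS
      have h3 := low x F hx hT Sᶜ hS.compl (by linarith)
      linarith [measureReal_nonneg (μ := tiltedLaw X δ F' x') (s := S)]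

variable [BorelSpace E]

lemma GeometricDrift.exists_integrable_exp (hA3 : GeometricDrift X δ ω) (hω : Continuous ω) :
    ∃ b ∈ Ioo (0 : ℝ) 1, ∃ N : ℝ → ℝ → ℝ, ∀ a l : ℝ, 0 < a → 0 < l → ∀ x,
      Integrable (fun w => Real.exp (a * X.timeIntegral δ ω w + l * ω (X.X δ w))) (X.P x) ∧
      ∫ w, Real.exp (a * X.timeIntegral δ ω w + l * ω (X.X δ w)) ∂(X.P x)
        ≤ Real.exp ((a + l * b) * ω x + N a l) := by
  obtain ⟨b, hb, M₁, M₂, h⟩ := hA3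
  refine ⟨b, hb, fun a l => a * M₁ (2 * a) + l * M₂ (2 * l), fun a l ha hl x => ?_⟩
  have h1 := lintegral_exp_le_of_entropicUtility_le (by positivity) (h (2 * a) x).1
  have h2 := lintegral_exp_le_of_entropicUtility_le (by positivity) (h (2 * l) x).2
  rw [mul_assoc 2 a (_ + _)] at h1
  rw [mul_assoc 2 l (_ + _)] at h2
  have := integrable_exp_add (X.measurable_timeIntegral hω δ)
    (hω.measurable.comp (X.measurable_X δ)) h1 h2
  refine ⟨this.1, this.2.trans_eq ?_⟩
  congr 1
  ring

lemma ModerateGrowth.integrable_exp {a m C κ : ℝ} {F : Ω → ℝ} (hω : Continuous ω)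
    (hF : ModerateGrowth X δ ω a m C κ F) {N : ℝ → ℝ → ℝ} {b : ℝ} {x : E}
    (H : ∀ a l : ℝ, 0 < a → 0 < l →
      Integrable (fun w => Real.exp (a * X.timeIntegral δ ω w + l * ω (X.X δ w))) (X.P x) ∧
      ∫ w, Real.exp (a * X.timeIntegral δ ω w + l * ω (X.X δ w)) ∂(X.P x)
        ≤ Real.exp ((a + l * b) * ω x + N a l))
    (ha : 0 < a) (hm : 0 < m) {σ : ℝ} (hσ : |σ| = 1) {l : ℝ} (hl : 0 ≤ l) :
    Integrable (fun w => Real.exp (σ * F w + l * ω (X.X δ w))) (X.P x) ∧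
      ∫ w, Real.exp (σ * F w + l * ω (X.X δ w)) ∂(X.P x)
        ≤ Real.exp ((a + (m + l) * b) * ω x + N a (m + l) + C + σ * κ) := by
  obtain ⟨hi, hb⟩ := H a (m + l) ha (by positivity)
  have bound : ∀ w, Real.exp (σ * F w + l * ω (X.X δ w)) ≤ Real.exp (C + σ * κ) *
      Real.exp (a * X.timeIntegral δ ω w + (m + l) * ω (X.X δ w)) := by
    intro w
    rw [← Real.exp_add]
    refine Real.exp_le_exp.2 ?_
    have h1 := (le_abs_self _).trans_eq (abs_mul σ (F w - κ))
    rw [hσ, one_mul] at h1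
    linarith [hF.2 w]
  have hm' : Measurable fun w => Real.exp (σ * F w + l * ω (X.X δ w)) :=
    ((hF.1.const_mul σ).add
      ((hω.measurable.comp (X.measurable_X δ)).const_mul l)).exp
  have i1 : Integrable (fun w => Real.exp (σ * F w + l * ω (X.X δ w))) (X.P x) :=
    (hi.const_mul _).mono' hm'.aestronglyMeasurable (ae_of_all _ fun w => by
      rw [Real.norm_eq_abs, abs_of_pos (Real.exp_pos _)]; exact bound w)
  refine ⟨i1, (integral_mono i1 (hi.const_mul _) bound).trans ?_⟩
  rw [integral_const_mul]
  refine (mul_le_mul_of_nonneg_left hb (Real.exp_pos _).le).trans_eq ?_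
  rw [← Real.exp_add]
  congr 1
  ring

/-- The uniform estimates for payoffs of moderate growth: the drift condition for the tilted laws, a
lower bound for the log-Laplace transform, and the comparison of the tilted law with the transition
law. None of the constants depends on the payoff. -/
lemma GeometricDrift.exists_tilted_bounds (hA3 : GeometricDrift X δ ω) (hω : Continuous ω)
    (hω0 : ∀ x, 0 ≤ ω x) {a m C : ℝ} (ha : 0 < a) (hm : 0 < m) :
    ∃ b ∈ Ioo (0 : ℝ) 1, ∃ K, 0 ≤ K ∧ ∃ k, 0 ≤ k ∧ ∃ k', ∀ x κ F,
      ModerateGrowth X δ ω a m C κ F →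
      Integrable (fun w => Real.exp (F w)) (X.P x) ∧
      IsProbabilityMeasure (tiltedLaw X δ F x) ∧
      Integrable ω (tiltedLaw X δ F x) ∧
      ∫ y, ω y ∂(tiltedLaw X δ F x) ≤ b * ω x + K ∧
      κ - (k * ω x + k') ≤ Real.log (∫ w, Real.exp (F w) ∂(X.P x)) ∧
      ∀ S, MeasurableSet S → (X.P x).real (X.X δ ⁻¹' S) ^ 2 ≤
        (tiltedLaw X δ F x).real S * Real.exp (2 * (k * ω x + k')) := by
  obtain ⟨b, hb, N, H⟩ := hA3.exists_integrable_exp hω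
  -- the slope of the drift is at most `b + 2 * (a + m) / l`; `l` makes this `(1 + b) / 2`
  set l : ℝ := 4 * (a + m) / (1 - b) with hl
  have hb1 : 0 < 1 - b := by linarith [hb.2]
  have hb0 : 0 < b := hb.1
  have lpos : 0 < l := by positivity
  refine ⟨(1 + b) / 2, ⟨by linarith [hb.1], by linarith [hb.2]⟩,
    max 0 ((N a (m + l) + N a m + 2 * C) / l), le_max_left _ _, a + m * b, by positivity,
    N a m + C, fun x κ F hF => ?_⟩
  have G := fun {σ : ℝ} (hσ : |σ| = 1) {l : ℝ} (hl : 0 ≤ l) =>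
    hF.integrable_exp hω (fun a l ha hl => H a l ha hl x) ha hm hσ hl
  have g1 := G (σ := 1) (by simp) (le_refl (0 : ℝ))
  have g2 := G (σ := -1) (by simp) (le_refl (0 : ℝ))
  have g3 := G (σ := 1) (by simp) lpos.le
  simp only [one_mul, neg_mul, zero_mul, add_zero] at g1 g2 g3
  have prob := isProbabilityMeasure_tilted g1.1
  have mX := X.measurable_X δ
  have iω : Integrable (fun w => ω (X.X δ w)) ((X.P x).tilted F) := by
    rw [integrable_tilted_iff g1.1]
    refine (g3.1.div_const l).mono'
      (hF.1.exp.mul (hω.measurable.comp mX)).aestronglyMeasurable (ae_of_all _ fun w => ?_)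
    rw [smul_eq_mul, Real.norm_eq_abs, abs_of_nonneg (mul_nonneg (Real.exp_pos _).le (hω0 _)),
      Real.exp_add, mul_div_assoc]
    gcongr
    rw [le_div_iff₀ lpos]
    linarith [Real.add_one_le_exp (l * ω (X.X δ w))]
  have mapint : ∫ y, ω y ∂(tiltedLaw X δ F x) = ∫ w, ω (X.X δ w) ∂((X.P x).tilted F) :=
    integral_map mX.aemeasurable hω.aestronglyMeasurable
  refine ⟨g1.1, Measure.isProbabilityMeasure_map mX.aemeasurable,
    (integrable_map_measure hω.aestronglyMeasurable mX.aemeasurable).2 iω, ?_, ?_, ?_⟩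
  · rw [mapint]
    have h1 := integral_tilted_le g1.1 g2.1 g3.1 iω g3.2 g2.2
    have h2 : (N a (m + l) + N a m + 2 * C) ≤ l * max 0 ((N a (m + l) + N a m + 2 * C) / l) := by
      rw [← div_le_iff₀' lpos]
      exact le_max_right _ _
    have h3 : l * (1 - b) = 4 * (a + m) := by rw [hl]; field_simp
    have h4 := hω0 x
    refine le_of_mul_le_mul_left ?_ lpos
    have h5 : l * ((1 + b) / 2 * ω x) = (l * b + 2 * (a + m)) * ω x := by
      linear_combination (ω x / 2) * h3
    have h6 : m * b * ω x ≤ m * ω x := by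
      gcongr
      nlinarith
    rw [mul_add, h5]
    linarith
  · have p1 := integral_exp_pos g1.1
    have p2 := integral_exp_pos g2.1
    have h1 := measureReal_sq_le_tilted g1.1 g2.1 univ
    simp only [probReal_univ, one_pow, one_mul] at h1
    have h2 := Real.log_nonneg h1
    rw [Real.log_mul p1.ne' p2.ne'] at h2
    have h3 := (Real.log_le_iff_le_exp p2).2 g2.2
    linarith
  · intro S hS
    have h1 := measureReal_sq_le_tilted g1.1 g2.1 (X.X δ ⁻¹' S)
    have e : (tiltedLaw X δ F x).real S = ((X.P x).tilted F).real (X.X δ ⁻¹' S) :=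
      map_measureReal_apply mX hS
    rw [e]
    refine h1.trans (mul_le_mul_of_nonneg_left ?_ measureReal_nonneg)
    calc _ ≤ _ := mul_le_mul g1.2 g2.2 (integral_exp_pos g2.1).le (Real.exp_pos _).le
      _ = _ := by rw [← Real.exp_add]; congr 1; ring

end TiltedLaw

/-! ### Weighted norms and infima -/

lemma exists_abs_le_of_weightedNorm_lt_top {E : Type*} {ω g : E → ℝ} (hω0 : ∀ x, 0 ≤ ω x)
    (h : weightedNorm 1 ω g < ∞) : ∃ k, 0 < k ∧ ∀ x, |g x| ≤ k * (1 + ω x) := by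
  refine ⟨(weightedNorm 1 ω g).toReal + 1, by positivity, fun x => ?_⟩
  have h1 : ENNReal.ofReal (|g x| / (1 + 1 * ω x)) ≤ weightedNorm 1 ω g :=
    le_iSup (fun x => ENNReal.ofReal (|g x| / (1 + 1 * ω x))) x
  have h2 := (ENNReal.ofReal_le_iff_le_toReal h.ne).1 h1
  have h3 : 0 < 1 + ω x := by linarith [hω0 x]
  rw [one_mul, div_le_iff₀ h3] at h2
  nlinarith

lemma weightedSpan_le_ofReal_iff {E : Type*} {β : ℝ} {ω g : E → ℝ} (hβ : 0 ≤ β)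
    (hω0 : ∀ x, 0 ≤ ω x) {D : ℝ} (hD : 0 ≤ D) :
    weightedSpan β ω g ≤ ENNReal.ofReal D ↔
      ∀ x y, g x - g y ≤ D * (2 + β * ω x + β * ω y) := by
  have pos : ∀ x y, 0 < 2 + β * ω x + β * ω y := fun x y => by
    have := mul_nonneg hβ (hω0 x)
    have := mul_nonneg hβ (hω0 y)
    linarith
  simp only [weightedSpan, iSup_le_iff, ENNReal.ofReal_le_ofReal_iff hD, div_le_iff₀ (pos _ _)]

/-- Comparing two infima at near-minimizers: `G₁` at a near-minimizer of `G₂`, and `H₂` at one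
of `H₁`. -/
lemma iInf_sub_iInf_sub_le {ι : Type*} [Nonempty ι] {G₁ G₂ H₁ H₂ : ι → ℝ} {B : ℝ}
    (hG : BddBelow (range G₁)) (hH : BddBelow (range H₂))
    (h : ∀ a a', (G₁ a - G₂ a) + (H₂ a' - H₁ a') ≤ B) :
    ((⨅ a, G₁ a) - ⨅ a, G₂ a) - ((⨅ a, H₁ a) - ⨅ a, H₂ a) ≤ B := by
  have h1 : ∀ a', (⨅ a, G₁ a) + (⨅ a, H₂ a) - B - H₁ a' ≤ ⨅ a, G₂ a := fun a' =>
    le_ciInf fun a => by linarith [h a a', ciInf_le hG a, ciInf_le hH a']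
  have h2 : (⨅ a, G₁ a) + (⨅ a, H₂ a) - B - (⨅ a, G₂ a) ≤ ⨅ a, H₁ a :=
    le_ciInf fun a' => by linarith [h1 a']
  linarith

lemma EReal.coe_ciSup {ι : Type*} [Nonempty ι] {r : ι → ℝ} (h : BddAbove (range r)) :
    ((⨆ a, r a : ℝ) : EReal) = ⨆ a, (r a : EReal) :=
  Monotone.map_ciSup_of_continuousAt continuous_coe_real_ereal.continuousAt
    (fun _ _ h => EReal.coe_le_coe_iff.2 h) h

/-- The numerical part of the Hairer-Mattingly argument, where `S` stands for `ω x + ω y`: for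
`R ≤ S` the drift contracts, for `S ≤ R` the total variation bound `θ` does if `β` is small. -/
lemma exists_contraction_constant {b K θ R : ℝ} (hb : b ∈ Ioo (0 : ℝ) 1) (hK : 0 ≤ K)
    (hθ : θ ∈ Ioo (0 : ℝ) 1) (hR : R = 4 * K / (1 - b) + 1) {β : ℝ} (hβ0 : 0 < β)
    (hβ : β * (2 * K + 1) ≤ 1 - θ) :
    ∃ L ∈ Ioo (0 : ℝ) 1, ∀ S, 0 ≤ S →
      (R ≤ S → 2 + β * (b * S + 2 * K) ≤ L * (2 + β * S)) ∧
      (S ≤ R → 2 * θ + β * (b * S + 2 * K) ≤ L * (2 + β * S)) := by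
  have hb1 : 0 < 1 - b := by linarith [hb.2]
  have hb0 := hb.1
  have hR0 : 0 < R := by rw [hR]; positivity
  have hRK : 4 * K ≤ (1 - b) * R := by
    rw [hR, mul_add, mul_div_cancel₀ _ hb1.ne']
    linarith
  -- the quotient `(2 + β * b' * S) / (2 + β * S)`, with `b' = (1 + b) / 2`, decreases in `S`
  set L₁ := (2 + β * ((1 + b) / 2 * R)) / (2 + β * R) with hL₁
  have hden : 0 < 2 + β * R := by positivity
  have hL₁lt : L₁ < 1 := by
    rw [hL₁, div_lt_one hden]
    have : (1 + b) / 2 * R < R := by nlinarith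
    gcongr
  have hθ1 := hθ.2
  refine ⟨max L₁ (max ((1 + θ) / 2) b), ⟨?_, ?_⟩, fun S hS => ⟨fun hRS => ?_, fun hSR => ?_⟩⟩
  · exact lt_max_of_lt_right (lt_max_of_lt_right hb.1)
  · exact max_lt hL₁lt (max_lt (by linarith) hb.2)
  · have h1 : b * S + 2 * K ≤ (1 + b) / 2 * S := by nlinarith
    have h2 : 2 + β * ((1 + b) / 2 * S) ≤ L₁ * (2 + β * S) := by
      rw [hL₁, div_mul_eq_mul_div (2 + β * ((1 + b) / 2 * R)), le_div_iff₀ hden]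
      nlinarith [mul_nonneg (mul_nonneg hβ0.le hb1.le) (sub_nonneg.2 hRS)]
    calc _ ≤ 2 + β * ((1 + b) / 2 * S) := by gcongr
      _ ≤ _ := h2
      _ ≤ _ := by gcongr; exact le_max_left _ _
  · calc 2 * θ + β * (b * S + 2 * K) ≤ (1 + θ) / 2 * 2 + b * (β * S) := by nlinarith
      _ ≤ max L₁ (max ((1 + θ) / 2) b) * 2 + max L₁ (max ((1 + θ) / 2) b) * (β * S) := by
          gcongr
          · exact (le_max_left _ _).trans (le_max_right _ _)
          · exact (le_max_right _ _).trans (le_max_right _ _)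
      _ = _ := by ring

/-! ### The Bellman operator -/

section Bellman

variable {E : Type*} [TopologicalSpace E] [MeasurableSpace E]
  {Ω : Type*} [MeasurableSpace Ω] {X : FellerMarkovProcess E Ω} {δ : ℝ≥0} {ω : E → ℝ}

/-- The exponent `γ ∫_0^δ f(X_s) ds + g(X_δ)` in the Bellman operator `T_γ`. -/
noncomputable def payoff (X : FellerMarkovProcess E Ω) (f : E → ℝ) (δ : ℝ≥0) (γ : ℝ)
    (g : E → ℝ) (w : Ω) : ℝ :=
  γ * X.timeIntegral δ f w + g (X.X δ w)

/-- The logarithm of the exponential moment `𝔼_x[exp(γ ∫_0^δ f(X_s) ds + g(X_δ))]`. -/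
noncomputable def logLaplace (X : FellerMarkovProcess E Ω) (f : E → ℝ) (δ : ℝ≥0) (γ : ℝ)
    (g : E → ℝ) (x : E) : ℝ :=
  Real.log (∫ w, Real.exp (payoff X f δ γ g w) ∂(X.P x))

/-- Since `γ < 0`, multiplication by `γ` turns the supremum defining `R_γ` into an infimum. It is
finite because costs are nonpositive and the log-Laplace transform is bounded below on `U`. -/
lemma bellmanT_eq_iInf {f g : E → ℝ} {γ : ℝ} {U : Set E} {c : E → U → ℝ} [Nonempty U]
    (hγ : γ < 0) (hi : ∀ z, Integrable (fun w => Real.exp (payoff X f δ γ g w)) (X.P z))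
    {l : ℝ} (hl : ∀ ξ ∈ U, l ≤ logLaplace X f δ γ g ξ) (hc : ∀ x ξ, c x ξ ≤ 0) (x : E) :
    BddBelow (range fun a : Bool × U =>
        logLaplace X f δ γ g (postActionState x a) + γ * actionCost c x a) ∧
      bellmanT X f c δ γ g x = ((⨅ a : Bool × U,
        (logLaplace X f δ γ g (postActionState x a) + γ * actionCost c x a) : ℝ) : EReal) := by
  have hbdd : BddBelow (range fun a : Bool × U =>
      logLaplace X f δ γ g (postActionState x a) + γ * actionCost c x a) := by
    refine ⟨min l (logLaplace X f δ γ g x), ?_⟩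
    rintro _ ⟨⟨a, ξ⟩, rfl⟩
    cases a
    · simp [postActionState, actionCost]
    · simp only [postActionState, actionCost, if_true]
      have := mul_nonneg_of_nonpos_of_nonpos hγ.le (hc x ξ)
      exact (min_le_left _ _).trans (by linarith [hl ξ ξ.2])
  refine ⟨hbdd, ?_⟩
  have hterm : ∀ a : Bool × U,
      entropicUtility γ (X.P (postActionState x a))
        (fun w => X.timeIntegral δ f w + g (X.X δ w) / γ) + (actionCost c x a : EReal)
      = ((1 / γ * (logLaplace X f δ γ g (postActionState x a) + γ * actionCost c x a) : ℝ) :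
          EReal) := by
    intro a
    have e : ∀ w, γ * (X.timeIntegral δ f w + g (X.X δ w) / γ) = payoff X f δ γ g w := by
      intro w
      rw [payoff, mul_add, mul_div_cancel₀ _ hγ.ne]
    have := X.prob (postActionState x a)
    rw [entropicUtility_eq_coe hγ.ne (by simpa only [e] using hi _)]
    simp only [e]
    rw [← EReal.coe_add, logLaplace, mul_add, ← mul_assoc, one_div_mul_cancel hγ.ne, one_mul]
  have hbdd' : BddAbove (range fun a : Bool × U =>
      1 / γ * (logLaplace X f δ γ g (postActionState x a) + γ * actionCost c x a)) := by
    obtain ⟨v, hv⟩ := hbdd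
    refine ⟨1 / γ * v, ?_⟩
    rintro _ ⟨a, rfl⟩
    exact mul_le_mul_of_nonpos_left (hv ⟨a, rfl⟩) (by simpa using hγ.le)
  rw [bellmanT, bellmanR]
  simp only [hterm]
  rw [← EReal.coe_ciSup hbdd', ← EReal.coe_mul, Real.mul_iSup_of_nonpos hγ.le]
  simp only [← mul_assoc, mul_one_div_cancel hγ.ne, one_mul]

variable [BorelSpace E]

lemma moderateGrowth_payoff {f g : E → ℝ} (hω : Continuous ω) (hf : Continuous f)
    (hg : Continuous g) {k : ℝ} (hfk : ∀ x, |f x| ≤ k * (1 + ω x)) {m C κ : ℝ}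
    (hgm : ∀ x, |g x - κ| ≤ m * ω x + C) (γ : ℝ) :
    ModerateGrowth X δ ω (|γ| * k) m (|γ| * k * δ + C) κ (payoff X f δ γ g) := by
  refine ⟨((X.measurable_timeIntegral hf δ).const_mul γ).add
    (hg.measurable.comp (X.measurable_X δ)), fun w => ?_⟩
  have h1 := mul_le_mul_of_nonneg_left (X.abs_timeIntegral_le hf hω hfk δ w) (abs_nonneg γ)
  rw [← abs_mul] at h1
  have h2 := abs_add_le (γ * X.timeIntegral δ f w) (g (X.X δ w) - κ)
  rw [payoff, add_sub_assoc]
  linarith [hgm (X.X δ w)]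

lemma logLaplace_sub_le {f f₁ f₂ : E → ℝ} {γ : ℝ} {z : E} (hf₁ : Continuous f₁)
    (hf₂ : Continuous f₂)
    (h₁ : Integrable (fun w => Real.exp (payoff X f δ γ f₁ w)) (X.P z))
    (h₂ : Integrable (fun w => Real.exp (payoff X f δ γ f₂ w)) (X.P z))
    (h : Integrable (fun y => f₁ y - f₂ y) (tiltedLaw X δ (payoff X f δ γ f₁) z)) :
    logLaplace X f δ γ f₁ z - logLaplace X f δ γ f₂ z
      ≤ ∫ y, (f₁ y - f₂ y) ∂(tiltedLaw X δ (payoff X f δ γ f₁) z) := by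
  have mX := (X.measurable_X δ).aemeasurable (μ := (X.P z).tilted (payoff X f δ γ f₁))
  have ms := (hf₁.sub hf₂).aestronglyMeasurable
    (μ := tiltedLaw X δ (payoff X f δ γ f₁) z)
  have e : ∀ w, payoff X f δ γ f₁ w - payoff X f δ γ f₂ w = f₁ (X.X δ w) - f₂ (X.X δ w) :=
    fun w => by simp [payoff]
  have h3 := (integrable_map_measure ms mX).1 h
  have := log_integral_exp_sub_le h₁ h₂ (by simp only [e]; exact h3)
  simp only [e] at this
  exact this.trans_eq (integral_map mX ms).symm

/-- The contraction at a fixed bound `M` on the spans, for an operator that is known to be the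
real-valued infimum `hT`. -/
lemma exists_contraction (hω : Continuous ω) (hω0 : ∀ x, 0 ≤ ω x) {U : Set E}
    (hU : IsCompact U) [Nonempty U] {f : E → ℝ} {c : E → U → ℝ} {γ : ℝ} (hγ : γ < 0)
    (hA1 : RewardCondition ω f) (hA3 : GeometricDrift X δ ω)
    (hA4 : LocalMinorization X δ ω U)
    (hT : ∀ g, WeightedContinuous ω g → ∀ x,
      BddBelow (range fun a : Bool × U =>
        logLaplace X f δ γ g (postActionState x a) + γ * actionCost c x a) ∧
      bellmanT X f c δ γ g x = ((⨅ a : Bool × U,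
        (logLaplace X f δ γ g (postActionState x a) + γ * actionCost c x a) : ℝ) : EReal))
    (M : ℝ≥0) :
    ∃ β₀ ∈ Ioo (0 : ℝ) 1, ∀ β, 0 < β → β ≤ β₀ → ∃ L ∈ Ioo (0 : ℝ) 1, ∀ f₁ f₂ : E → ℝ,
      WeightedContinuous ω f₁ → WeightedContinuous ω f₂ →
      weightedSpan 1 ω f₁ ≤ M → weightedSpan 1 ω f₂ ≤ M →
      weightedSpan β ω
          (fun x => (bellmanT X f c δ γ f₁ x).toReal - (bellmanT X f c δ γ f₂ x).toReal)
        ≤ ENNReal.ofReal L * weightedSpan β ω (fun x => f₁ x - f₂ x) := by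
  obtain ⟨kf, hkf0, hkf⟩ := exists_abs_le_of_weightedNorm_lt_top hω0 hA1.2
  obtain ⟨y₀, hy₀⟩ := ‹Nonempty U›
  have : Nonempty U := ⟨y₀, hy₀⟩
  obtain ⟨W, hW⟩ := hU.bddAbove_image hω.continuousOn
  have hW' : ∀ ξ ∈ U, ω ξ ≤ W := fun ξ hξ => hW ⟨ξ, hξ, rfl⟩
  have hW0 : 0 ≤ W := (hω0 y₀).trans (hW' y₀ hy₀)
  -- an impulse moves the state into `U`, where `ω ≤ W`
  have hpost : ∀ x (a : Bool × U), ω (postActionState x a) ≤ ω x + W := by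
    rintro x ⟨a, ξ⟩
    cases a
    · simpa [postActionState] using hW0
    · simp only [postActionState, if_true]
      linarith [hW' ξ ξ.2, hω0 x]
  have ha : 0 < |γ| * kf := mul_pos (abs_pos.2 hγ.ne) hkf0
  obtain ⟨b, hb, K, hK, k, hk, k', H⟩ := hA3.exists_tilted_bounds hω hω0 (m := M + 1)
    (C := |γ| * kf * δ + M * (2 + ω y₀)) ha (by positivity)
  have hbW : 0 ≤ b * W := mul_nonneg hb.1.le hW0
  have hb1 : 0 < 1 - b := by linarith [hb.2]
  set K' := K + b * W with hK'
  have hK'0 : 0 ≤ K' := by positivity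
  set R := 4 * K' / (1 - b) + 1 with hR
  have hR0 : 0 < R := by positivity
  obtain ⟨θ, hθ, hTV⟩ := hA4.exists_tiltedLaw_sub_le (k' := k') hk (R := R + W) (by positivity)
  have hθ1 : 0 < 1 - θ := by linarith [hθ.2]
  refine ⟨min (1 / 2) ((1 - θ) / (2 * K' + 1)), ⟨by positivity,
    (min_le_left _ _).trans_lt (by norm_num)⟩, fun β hβ0 hβ => ?_⟩
  obtain ⟨L, hL, hL'⟩ := exists_contraction_constant hb hK'0 hθ hR hβ0
    ((le_div_iff₀ (by positivity)).1 (hβ.trans (min_le_right _ _)))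
  refine ⟨L, hL, fun f₁ f₂ hf₁ hf₂ hs₁ hs₂ => ?_⟩
  -- the inequality is trivial if the span on the right is infinite
  by_cases hD : weightedSpan β ω (fun x => f₁ x - f₂ x) = ∞
  · rw [hD, ENNReal.mul_top (by simpa using hL.1)]
    exact le_top
  set D := (weightedSpan β ω (fun x => f₁ x - f₂ x)).toReal with hDdef
  have hD0 : 0 ≤ D := ENNReal.toReal_nonneg
  have hspan := (weightedSpan_le_ofReal_iff hβ0.le hω0 hD0).1 (ENNReal.ofReal_toReal hD).ge
  rw [← ENNReal.ofReal_toReal hD, ← ENNReal.ofReal_mul hL.1.le]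
  refine (weightedSpan_le_ofReal_iff hβ0.le hω0 (mul_nonneg hL.1.le hD0)).2 fun x y => ?_
  have growth : ∀ g, WeightedContinuous ω g → weightedSpan 1 ω g ≤ M →
      ModerateGrowth X δ ω (|γ| * kf) (M + 1) (|γ| * kf * δ + M * (2 + ω y₀)) (g y₀)
        (payoff X f δ γ g) := by
    intro g hg hs
    rw [← ENNReal.ofReal_coe_nnreal,
      weightedSpan_le_ofReal_iff zero_le_one hω0 M.coe_nonneg] at hs
    refine moderateGrowth_payoff hω hA1.1 hg.1 hkf (fun x => abs_le.2 ⟨?_, ?_⟩) γ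
    · linarith [hs y₀ x, hω0 x]
    · linarith [hs x y₀, hω0 x]
  have B₁ := fun z => H z _ _ (growth f₁ hf₁ hs₁)
  have B₂ := fun z => H z _ _ (growth f₂ hf₂ hs₂)
  obtain ⟨k₁, -, hk₁⟩ := exists_abs_le_of_weightedNorm_lt_top hω0 hf₁.2
  obtain ⟨k₂, -, hk₂⟩ := exists_abs_le_of_weightedNorm_lt_top hω0 hf₂.2
  have hint : ∀ (Q : Measure E), IsProbabilityMeasure Q → Integrable ω Q →
      Integrable (fun y => f₁ y - f₂ y) Q := by
    intro Q _ hQ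
    refine (((integrable_const 1).add hQ).const_mul (k₁ + k₂)).mono'
      (hf₁.1.sub hf₂.1).aestronglyMeasurable (ae_of_all _ fun y => ?_)
    have := abs_sub (f₁ y) (f₂ y)
    rw [Real.norm_eq_abs, Pi.add_apply]
    linarith [hk₁ y, hk₂ y]
  simp only [fun x => (hT f₁ hf₁ x).2, fun x => (hT f₂ hf₂ x).2, EReal.toReal_coe]
  -- the action costs cancel, and what remains is a difference of two tilted integrals
  refine iInf_sub_iInf_sub_le (hT f₁ hf₁ x).1 (hT f₂ hf₂ y).1 fun a a' => ?_
  obtain ⟨i₁, p₁, iω₁, d₁, -, t₁⟩ := B₁ (postActionState x a)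
  obtain ⟨i₂, p₂, iω₂, d₂, -, t₂⟩ := B₂ (postActionState y a')
  have l₁ := logLaplace_sub_le hf₁.1 hf₂.1 i₁ (B₂ (postActionState x a)).1 (hint _ p₁ iω₁)
  have i' : Integrable (fun y => f₂ y - f₁ y)
      (tiltedLaw X δ (payoff X f δ γ f₂) (postActionState y a')) :=
    (hint _ p₂ iω₂).neg.congr (ae_of_all _ fun y => by simp)
  have l₂ := logLaplace_sub_le hf₂.1 hf₁.1 i₂ (B₁ (postActionState y a')).1 i'
  have e₂ : ∫ y, (f₂ y - f₁ y) ∂(tiltedLaw X δ (payoff X f δ γ f₂) (postActionState y a'))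
      = -∫ y, (f₁ y - f₂ y) ∂(tiltedLaw X δ (payoff X f δ γ f₂) (postActionState y a')) := by
    rw [← integral_neg]; simp
  rw [e₂] at l₂
  have q := fun θ => integral_sub_integral_le_of_span_le (θ := θ) (hf₁.1.sub hf₂.1).measurable hω0
    iω₁ iω₂ hD0 hβ0.le hspan
  simp only [Pi.sub_apply] at q
  have hx := hpost x a
  have hy := hpost y a'
  have hdrift : β * ∫ y, ω y ∂(tiltedLaw X δ (payoff X f δ γ f₁) (postActionState x a))
      + β * ∫ y, ω y ∂(tiltedLaw X δ (payoff X f δ γ f₂) (postActionState y a'))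
      ≤ β * (b * (ω x + ω y) + 2 * K') := by
    rw [← mul_add]
    refine mul_le_mul_of_nonneg_left ?_ hβ0.le
    have := mul_le_mul_of_nonneg_left hx hb.1.le
    have := mul_le_mul_of_nonneg_left hy hb.1.le
    rw [hK']
    linarith
  have main : ∀ θ' : ℝ, (∀ s, MeasurableSet s →
      (tiltedLaw X δ (payoff X f δ γ f₁) (postActionState x a)).real s -
        (tiltedLaw X δ (payoff X f δ γ f₂) (postActionState y a')).real s ≤ θ') →
      2 * θ' + β * (b * (ω x + ω y) + 2 * K') ≤ L * (2 + β * (ω x + ω y)) →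
      (logLaplace X f δ γ f₁ (postActionState x a) + γ * actionCost c x a
        - (logLaplace X f δ γ f₂ (postActionState x a) + γ * actionCost c x a))
      + (logLaplace X f δ γ f₂ (postActionState y a') + γ * actionCost c y a'
        - (logLaplace X f δ γ f₁ (postActionState y a') + γ * actionCost c y a'))
      ≤ L * D * (2 + β * ω x + β * ω y) := by
    intro θ' h1 h2
    have h3 := (q θ' h1).trans (mul_le_mul_of_nonneg_left
      ((add_assoc _ _ _).trans_le (add_le_add_right hdrift _) |>.trans h2) hD0)
    linarith
  obtain ⟨far, near⟩ := hL' (ω x + ω y) (add_nonneg (hω0 x) (hω0 y))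
  rcases le_total R (ω x + ω y) with hS | hS
  · -- no information on the total variation distance is needed here
    refine main 1 (fun s _ => ?_) (by simpa using far hS)
    linarith [measureReal_le_one
      (μ := tiltedLaw X δ (payoff X f δ γ f₁) (postActionState x a)) (s := s),
      measureReal_nonneg
      (μ := tiltedLaw X δ (payoff X f δ γ f₂) (postActionState y a')) (s := s)]
  · refine main θ (hTV _ _ _ _ ?_ ?_ p₁ t₁ t₂) (near hS)
    · linarith [hω0 y]
    · linarith [hω0 x]

lemma bellmanT_eq_iInf_of_weightedContinuous (hω : Continuous ω) (hω0 : ∀ x, 0 ≤ ω x)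
    {U : Set E} (hU : IsCompact U) [Nonempty U] {f : E → ℝ} {c : E → U → ℝ} {γ : ℝ} (hγ : γ < 0)
    (hA1 : RewardCondition ω f) (hA2 : ShiftCostCondition ω c) (hA3 : GeometricDrift X δ ω)
    {g : E → ℝ} (hg : WeightedContinuous ω g) (x : E) :
    BddBelow (range fun a : Bool × U =>
        logLaplace X f δ γ g (postActionState x a) + γ * actionCost c x a) ∧
      bellmanT X f c δ γ g x = ((⨅ a : Bool × U,
        (logLaplace X f δ γ g (postActionState x a) + γ * actionCost c x a) : ℝ) : EReal) := by
  obtain ⟨kf, hkf0, hkf⟩ := exists_abs_le_of_weightedNorm_lt_top hω0 hA1.2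
  obtain ⟨kg, hkg0, hkg⟩ := exists_abs_le_of_weightedNorm_lt_top hω0 hg.2
  obtain ⟨c₀, hc₀, hc⟩ := hA2.2.1
  obtain ⟨W, hW⟩ := hU.bddAbove_image hω.continuousOn
  have ha : 0 < |γ| * kf := mul_pos (abs_pos.2 hγ.ne) hkf0
  obtain ⟨b, -, K, -, k, hk, k', H⟩ := hA3.exists_tilted_bounds hω hω0
    (C := |γ| * kf * δ + kg) ha hkg0
  have B := fun z => H z 0 _ (moderateGrowth_payoff (X := X) (δ := δ) hω hA1.1 hg.1 hkf
    (m := kg) (C := kg) (κ := 0) (fun x => by rw [sub_zero]; linarith [hkg x]) γ)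
  refine bellmanT_eq_iInf hγ (fun z => (B z).1) (l := 0 - (k * W + k')) (fun ξ hξ => ?_)
    (fun x ξ => (hc x ξ).trans hc₀.le) x
  refine le_trans ?_ (B ξ).2.2.2.2.1
  have := mul_le_mul_of_nonneg_left (hW ⟨ξ, hξ, rfl⟩) hk
  linarith

end Bellman

theorem theorem1 {E : Type*} [TopologicalSpace E] [T2Space E] [LocallyCompactSpace E]
    [SecondCountableTopology E] [MeasurableSpace E] [BorelSpace E]
    {Ω : Type*} [MeasurableSpace Ω] (X : FellerMarkovProcess E Ω)
    (ω : E → ℝ) (hω : Continuous ω) (hω0 : ∀ x, 0 ≤ ω x)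
    (U : Set E) (hU : IsCompact U) (f : E → ℝ) (c : E → U → ℝ)
    (δ : ℝ≥0) (hδ : 0 < δ) (γ : ℝ) (hγ : γ < 0)
    (hA1 : RewardCondition ω f) (hA2 : ShiftCostCondition ω c)
    (hA3 : GeometricDrift X δ ω) (hA4 : LocalMinorization X δ ω U) :
    (∀ g, WeightedContinuous ω g → ∀ x,
      bellmanT X f c δ γ g x ≠ ⊤ ∧ bellmanT X f c δ γ g x ≠ ⊥) ∧
    ∃ β₀ : ℝ≥0 → ℝ, (∀ M, β₀ M ∈ Ioo (0 : ℝ) 1) ∧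
      ∀ β : ℝ≥0 → ℝ, (∀ M, 0 < β M ∧ β M ≤ β₀ M) →
        ∃ L : ℝ≥0 → ℝ, (∀ M, L M ∈ Ioo (0 : ℝ) 1) ∧
          ∀ (M : ℝ≥0) (f₁ f₂ : E → ℝ),
            WeightedContinuous ω f₁ → WeightedContinuous ω f₂ →
            weightedSpan 1 ω f₁ ≤ M → weightedSpan 1 ω f₂ ≤ M →
            weightedSpan (β M) ω
                (fun x => (bellmanT X f c δ γ f₁ x).toReal - (bellmanT X f c δ γ f₂ x).toReal)
              ≤ ENNReal.ofReal (L M) * weightedSpan (β M) ω (fun x => f₁ x - f₂ x) := by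
  have : Nonempty U := by
    obtain ⟨d, -, ν, -, -, hνU⟩ := hA4 1 one_pos
    exact (nonempty_of_measure_ne_zero hνU.ne').to_subtype
  have hT := fun g (hg : WeightedContinuous ω g) =>
    bellmanT_eq_iInf_of_weightedContinuous hω hω0 hU hγ hA1 hA2 hA3 hg
  refine ⟨fun g hg x => ?_, ?_⟩
  · rw [(hT g hg x).2]
    exact ⟨EReal.coe_ne_top _, EReal.coe_ne_bot _⟩
  · choose β₀ hβ₀ h using exists_contraction hω hω0 hU hγ hA1 hA3 hA4 hT
    refine ⟨β₀, hβ₀, fun β hβ => ?_⟩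
    choose L hL h' using fun M => h M (β M) (hβ M).1 (hβ M).2
    exact ⟨L, hL, h'⟩
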